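/- **Model.** A team $R$ of $n\ge 1$ robots, viewed as points, moves in the Euclidean plane in synchronous rounds $t=0,1,2,\dots$ The robots are anonymous and execute the same deterministic protocol. In $\mathcal{LUMI}$ each robot carries a persistent light whose color belongs to a finite set $K$ fixed by the protocol; all lights initially have the color "off". A robot active in round $t$ performs a Look-Compute-Move cycle: it takes a snapshot, the set of pairs (position, color) of all robots it observes (itself included), positions being expressed in its local coordinate system, which is centred at the robot and may have any orientation, handedness and unit of length; from its own color and the snapshot the protocol determines a destination (which the robot reaches within the round) and a new color. Inactive robots do not change. The adversary chooses the local coordinate systems (possibly different for each robot and round) from a nonempty set of assignments belonging to the team, which expresses how far the team agrees on its coordinate systems. With full visibility ($F.V.$) every robot observes all robots; with limited visibility ($L.V.$) it observes exactly those at distance at most $V_r$, where $V_r>0$ is a common radius belonging to the team. Under FSYNCH ($F$) all robots are active in every round; under SSYNCH ($S$) the adversary chooses a nonempty set of active robots in each round, so that every robot is active infinitely often. A *problem* for $n$ robots consists of a set of initial placements and a set of valid sequences of placements (one per round, starting with the initial one). A team $R$ *solves* it in $\mathcal{LUMI}^{X}_{V}$ if there is a protocol (which may depend on $R$) such that, from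 every initial placement of the problem whose visibility graph for the radius $V_r$ of $R$ (robots at distance at most $V_r$ are adjacent) is connected, and for all admissible choices of the adversary, the resulting sequence of placements is valid. Write $\mathcal{LUMI}^{X}_{V}(R)$ for the set of problems solved by $R$. Two models $M,N$ are *incomparable*, $M\perp N$, if there are teams $R_1,R_2$ with $M(R_1)\setminus N(R_1)\ne\emptyset$ and $N(R_2)\setminus M(R_2)\ne\emptyset$. **EqOsc** (three robots). Initially $r_1,r_2,r_3$ are at $B,A,C$, where $B\neq C$ and $A$ is the midpoint of $BC$. Let $B'$, $C'$ be the points of the segments $AB$, $AC$ with $AB'=\frac23AB$ and $AC'=\frac23AC$. In every round $r_2$ is at $A$, and $r_1$, $r_3$ are equidistant from $A$; whenever $r_1,r_3$ are at $B,C$ in some round, they are at $B',C'$ in some later round; whenever they are at $B',C'$, they are at $B,C$ in some later round. **AE** (four robots). Initially $r_1,r_2,r_3,r_4$ are at $A,B,C,D$ such that $AB$ makes an angle $\theta_1$ with the extension of $CB$ beyond $B$, $CD$ makes an angle $\theta_2$ with the extension of $BC$ beyond $C$, $0<\theta_1<\theta_2<90^\circ$, and each of the distances $AB,BC,CD$ is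 smaller than each of $AC,BD,AD$. The robots $r_2,r_3$ stay at $B,C$ forever. After finitely many rounds a placement must be reached, and never left, in which $r_2r_1$ and $r_3r_4$ both make the angle $\theta_2$ with the respective extensions of the segment $BC$; in all earlier rounds these two angles must be $\theta_1$ and $\theta_2$. There are no collisions: in each round the straight paths (possibly single points) of different robots do not meet. **Theorem.** $\mathcal{LUMI}^{F}_{L.V.}\perp\mathcal{LUMI}^{S}_{F.V.}$. More precisely, for every team $R$ of three robots, $EqOsc\in\mathcal{LUMI}^{F}_{L.V.}(R)\setminus\mathcal{LUMI}^{S}_{F.V.}(R)$, and for every team $R$ of four robots, $AE\in\mathcal{LUMI}^{S}_{F.V.}(R)\setminus\mathcal{LUMI}^{F}_{L.V.}(R)$. -/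

import Mathlib

namespace Robots

/-- The Euclidean plane in which the robots move. -/
abbrev Plane : Type := EuclideanSpace ℝ (Fin 2)

/-- The positions of `n` robots. -/
abbrev Placement (n : ℕ) : Type := Fin n → Plane

/-! ### Local coordinate systems and teams -/

/-- Axes, handedness and unit of length of a local coordinate system; its origin is always the
position of the observing robot. Reflections are allowed: there is no common chirality. -/
structure Frame where
  axes : Plane ≃ₗᵢ[ℝ] Plane
  scale : ℝ
  scale_pos : 0 < scale

namespace Frame

/-- Local coordinates of the point `x` for a robot standing at `p`. -/
noncomputable def toLocal (f : Frame) (p x : Plane) : Plane :=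
  f.scale • f.axes (x - p)

/-- The point whose local coordinates are `y`, for a robot standing at `p`. -/
noncomputable def toGlobal (f : Frame) (p y : Plane) : Plane :=
  p + f.axes.symm (f.scale⁻¹ • y)

theorem toGlobal_toLocal (f : Frame) (p x : Plane) : f.toGlobal p (f.toLocal p x) = x := by
  simp [toGlobal, toLocal, smul_smul, inv_mul_cancel₀ f.scale_pos.ne']

end Frame

/-- A team of `n` robots. `radius` is the common radius of the circles of visibility. `frames` is
the set of assignments (round, robot) ↦ local coordinate system which the adversary may choose; it
expresses how far the robots agree on their coordinate systems (all assignments: no agreement at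
all; constant assignments: a common coordinate system). -/
structure Team (n : ℕ) where
  size_pos : 0 < n
  radius : ℝ
  radius_pos : 0 < radius
  frames : Set (ℕ → Fin n → Frame)
  frames_nonempty : frames.Nonempty

/-! ### Visibility and schedulers -/

/-- Full or limited visibility. -/
inductive Visibility
  | full
  | limited

/-- Whether a robot at `p` observes the point `q`. -/
def Visibility.Sees (v : Visibility) (radius : ℝ) (p q : Plane) : Prop :=
  match v with
  | .full => True
  | .limited => dist p q ≤ radius

/-- The visibility graph of a placement with respect to the given radius. -/
def visibilityGraph {n : ℕ} (radius : ℝ) (c : Placement n) : SimpleGraph (Fin n) where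
  Adj i j := i ≠ j ∧ dist (c i) (c j) ≤ radius
  symm := ⟨fun i j h => ⟨h.1.symm, by rw [dist_comm]; exact h.2⟩⟩
  loopless := ⟨fun _ h => h.1 rfl⟩

/-- Fully synchronous or semi-synchronous scheduler. -/
inductive Scheduler
  | fsynch
  | ssynch

/-- The activation sequences which the scheduler may choose: all robots in every round, or a fair
sequence of nonempty sets of robots. -/
def Scheduler.Admits (s : Scheduler) {n : ℕ} (act : ℕ → Set (Fin n)) : Prop :=
  match s with
  | .fsynch => ∀ t, act t = Set.univ
  | .ssynch => (∀ t, (act t).Nonempty) ∧ ∀ i t, ∃ t', t ≤ t' ∧ i ∈ act t'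

/-! ### The model `LUMI` -/

/-- A protocol for robots with lights, executed by all robots. `Color` is the finite set of colors
and `off` the initial one. From the color of its own light and the colored snapshot, in its local
coordinates, a robot computes its destination, in its local coordinates, and its new color. -/
structure Protocol where
  Color : Type
  finite_color : Finite Color
  off : Color
  compute : Color → Set (Plane × Color) → Plane × Color

/-- The colored snapshot of robot `i`: the set of pairs (position, color) of the robots which it
observes (itself included), the positions being in its local coordinate system. -/
def snapshot {n : ℕ} {C : Type} (v : Visibility) (radius : ℝ) (f : Frame)
    (c : Fin n → Plane × C) (i : Fin n) : Set (Plane × C) :=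
  {q | ∃ j, v.Sees radius (c i).1 (c j).1 ∧ q = (f.toLocal (c i).1 (c j).1, (c j).2)}

open Classical in
/-- The configuration (position and color of each robot) at the beginning of each round. In round
`t` the robots of `act t` perform a Look-Compute-Move cycle, and reach their destinations. -/
noncomputable def Protocol.run (P : Protocol) {n : ℕ} (v : Visibility) (radius : ℝ)
    (frame : ℕ → Fin n → Frame) (act : ℕ → Set (Fin n)) (c₀ : Placement n) :
    ℕ → Fin n → Plane × P.Color
  | 0 => fun i => (c₀ i, P.off)
  | t + 1 => fun i =>
      let c := P.run v radius frame act c₀ t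
      if i ∈ act t then
        let out := P.compute (c i).2 (snapshot v radius (frame t i) c i)
        ((frame t i).toGlobal (c i).1 out.1, out.2)
      else c i

/-- A problem for `n` robots: the initial placements, and the sequences of placements (one for each
round, the first being the initial placement) which fulfil the task. -/
structure Problem (n : ℕ) where
  initial : Set (Placement n)
  valid : Set (ℕ → Placement n)

/-- The set of problems which the team `R` solves with lights, under the scheduler `s` and with
visibility `v`: some protocol fulfils the task from every initial placement whose visibility graph
is connected, whatever admissible activations and local coordinate systems the adversary chooses. -/
def LUMI (s : Scheduler) (v : Visibility) (n : ℕ) (R : Team n) : Set (Problem n) :=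
  {Q | ∃ P : Protocol, ∀ c₀ ∈ Q.initial, (visibilityGraph R.radius c₀).Connected →
    ∀ frame ∈ R.frames, ∀ act : ℕ → Set (Fin n), s.Admits act →
      (fun t i => (P.run v R.radius frame act c₀ t i).1) ∈ Q.valid}

/-- Two models are (computationally) incomparable. A model is given by the set of problems which it
lets each team solve. -/
def Incomparable (M N : (n : ℕ) → Team n → Set (Problem n)) : Prop :=
  (∃ (n : ℕ) (R : Team n), (M n R \ N n R).Nonempty) ∧
  (∃ (n : ℕ) (R : Team n), (N n R \ M n R).Nonempty)

/-! ### The problem `EqOsc` (equivalent oscillation)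

Robots `0`, `1`, `2` are `r₁`, `r₂`, `r₃`, initially at `B`, `A`, `C`. -/

noncomputable def EqOsc : Problem 3 where
  initial := {c | c 0 ≠ c 2 ∧ c 1 = midpoint ℝ (c 0) (c 2)}
  valid := {c |
    let B := c 0 0
    let A := c 0 1
    let C := c 0 2
    let B' := AffineMap.lineMap (k := ℝ) A B (2 / 3 : ℝ)
    let C' := AffineMap.lineMap (k := ℝ) A C (2 / 3 : ℝ)
    (∀ t, c t 1 = A ∧ dist (c t 0) A = dist (c t 2) A) ∧
    (∀ t, c t 0 = B → c t 2 = C → ∃ t', t < t' ∧ c t' 0 = B' ∧ c t' 2 = C') ∧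
    (∀ t, c t 0 = B' → c t 2 = C' → ∃ t', t < t' ∧ c t' 0 = B ∧ c t' 2 = C)}

/-! ### The problem `AE` (angle equalization)

Robots `0`, `1`, `2`, `3` are `r₁`, `r₂`, `r₃`, `r₄`, initially at `A`, `B`, `C`, `D`. -/

/-- The angle at `Y` between the segment `YX` and the extension of `ZY` beyond `Y`. -/
noncomputable def extAngle (X Y Z : Plane) : ℝ :=
  InnerProductGeometry.angle (X - Y) (Y - Z)

/-- Robots `r₂`, `r₃` are at `B`, `C`, and `r₁r₂`, `r₄r₃` make the angles `α`, `β` with the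
extensions of `BC`. (An acute angle forces `r₁ ≠ r₂`, `r₂ ≠ r₃`, `r₄ ≠ r₃`.) -/
def HasAngles (B C : Plane) (α β : ℝ) (c : Placement 4) : Prop :=
  c 1 = B ∧ c 2 = C ∧ extAngle (c 0) B C = α ∧ extAngle (c 3) C B = β

/-- Robots on consecutive positions of the path `A B C D` are closer to each other than robots on
non-consecutive ones. -/
def IsOpenPath (c : Placement 4) : Prop :=
  ∀ x ∈ ({dist (c 0) (c 1), dist (c 1) (c 2), dist (c 2) (c 3)} : Set ℝ),
    ∀ y ∈ ({dist (c 0) (c 2), dist (c 1) (c 3), dist (c 0) (c 3)} : Set ℝ), x < y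

/-- No collision in any round, whatever the speeds: the ways of different robots do not meet. -/
def CollisionFree {n : ℕ} (c : ℕ → Placement n) : Prop :=
  ∀ t i j, i ≠ j →
    Disjoint (segment ℝ (c t i) (c (t + 1) i)) (segment ℝ (c t j) (c (t + 1) j))

noncomputable def AE : Problem 4 where
  initial := {c |
    let θ₁ := extAngle (c 0) (c 1) (c 2)
    let θ₂ := extAngle (c 3) (c 2) (c 1)
    0 < θ₁ ∧ θ₁ < θ₂ ∧ θ₂ < Real.pi / 2 ∧ IsOpenPath c}
  valid := {c |
    let B := c 0 1
    let C := c 0 2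
    let θ₁ := extAngle (c 0 0) B C
    let θ₂ := extAngle (c 0 3) C B
    CollisionFree c ∧
    ∃ T, (∀ t < T, HasAngles B C θ₁ θ₂ (c t)) ∧ HasAngles B C θ₂ θ₂ (c T) ∧ ∀ t ≥ T, c t = c T}

end Robots

namespace Robots

/-! All four memberships hold whatever the agreement on coordinate systems. `EqOsc`: if robots are
activated one at a time, at most one of r₁, r₃ moves in a round, and equidistance from A then
freezes their common distance (`eqOsc_notMem_ssynch_full`). In FSYNCH the lights flip together and
give the parity of the round. Every robot finds A in its snapshot (`eqOscCentre_snapshot`), so the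
team alternates a contraction with its inverse. `AE`, solvable: the set of points of an initial
placement admits only one labelling (`initial_labelling_unique`), so with full visibility anonymous
robots identify themselves. Only r₁ ever acts: it jumps once to the point reflection of r₄, at its
first activation. `AE`, unsolvable: take BC equal to the visibility radius. While both angles are
acute, r₁ and r₂ do not see r₄, and r₃ stands still, so all they learn about θ₂ is the word of
colors shown by r₃ (`run_eq_of_separated`). These finite words are countably many and the angles
uncountably many, so two angles would lead r₁ to the same final position. -/

theorem Protocol.run_succ_of_mem (P : Protocol) {n : ℕ} (v : Visibility) (radius : ℝ)
    (frame : ℕ → Fin n → Frame) (act : ℕ → Set (Fin n)) (c₀ : Placement n) {t : ℕ} {i : Fin n}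
    (h : i ∈ act t) :
    P.run v radius frame act c₀ (t + 1) i =
      ((frame t i).toGlobal (P.run v radius frame act c₀ t i).1
        (P.compute (P.run v radius frame act c₀ t i).2
          (snapshot v radius (frame t i) (P.run v radius frame act c₀ t) i)).1,
        (P.compute (P.run v radius frame act c₀ t i).2
          (snapshot v radius (frame t i) (P.run v radius frame act c₀ t) i)).2) := by
  rw [Protocol.run]
  simp [h]

theorem Protocol.run_succ_of_notMem (P : Protocol) {n : ℕ} (v : Visibility) (radius : ℝ)
    (frame : ℕ → Fin n → Frame) (act : ℕ → Set (Fin n)) (c₀ : Placement n) {t : ℕ} {i : Fin n}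
    (h : i ∉ act t) :
    P.run v radius frame act c₀ (t + 1) i = P.run v radius frame act c₀ t i := by
  rw [Protocol.run]
  simp [h]

/-! ### Local coordinates as similarities of the plane -/

namespace Frame

theorem toLocal_self (f : Frame) (p : Plane) : f.toLocal p p = 0 := by simp [toLocal]

theorem toGlobal_zero (f : Frame) (p : Plane) : f.toGlobal p 0 = p := by simp [toGlobal]

theorem toLocal_injective (f : Frame) (p : Plane) : Function.Injective (f.toLocal p) :=
  Function.LeftInverse.injective (f.toGlobal_toLocal p)

theorem toLocal_eq_zero_iff (f : Frame) {p x : Plane} : f.toLocal p x = 0 ↔ x = p := by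
  rw [← f.toLocal_self p, (f.toLocal_injective p).eq_iff]

theorem toLocal_add_smul (f : Frame) (p v : Plane) (r : ℝ) :
    f.toLocal p (p + r • v) = r • f.toLocal p (p + v) := by
  simp [toLocal, smul_comm r]

/-- Axes and unit cancel: a move by a fixed multiple of an observed vector does not depend on the
local frame. -/
theorem toGlobal_smul_toLocal (f : Frame) (p x : Plane) (r : ℝ) :
    f.toGlobal p (r • f.toLocal p x) = p + r • (x - p) := by
  rw [← f.toGlobal_toLocal p (p + r • (x - p)), toLocal_add_smul, add_sub_cancel]

theorem toLocal_sub_toLocal (f : Frame) (p x y : Plane) :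
    f.toLocal p x - f.toLocal p y = f.scale • f.axes (x - y) := by
  simp [toLocal, smul_sub]

theorem dist_toLocal (f : Frame) (p x y : Plane) :
    dist (f.toLocal p x) (f.toLocal p y) = f.scale * dist x y := by
  rw [dist_eq_norm, toLocal_sub_toLocal, norm_smul, Real.norm_of_nonneg f.scale_pos.le,
    LinearIsometryEquiv.norm_map, dist_eq_norm]

theorem extAngle_toLocal (f : Frame) (p x y z : Plane) :
    extAngle (f.toLocal p x) (f.toLocal p y) (f.toLocal p z) = extAngle x y z := by
  rw [extAngle, toLocal_sub_toLocal, toLocal_sub_toLocal,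
    InnerProductGeometry.angle_smul_smul f.scale_pos.ne', extAngle]
  exact f.axes.toLinearIsometry.angle_map _ _

end Frame

instance : Nonempty Frame := ⟨⟨.refl ℝ Plane, 1, one_pos⟩⟩

/-- A team without any agreement on the coordinate systems. -/
def disorientedTeam (n : ℕ) (hn : 0 < n) : Team n where
  size_pos := hn
  radius := 1
  radius_pos := one_pos
  frames := Set.univ
  frames_nonempty := Set.univ_nonempty

/-! ### `EqOsc` is not solvable under `SSYNCH` -/

theorem eqOsc_notMem_ssynch_full (R : Team 3) : EqOsc ∉ LUMI .ssynch .full 3 R := by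
  rintro ⟨P, hP⟩
  have hV := R.radius_pos
  obtain ⟨frame, hframe⟩ := R.frames_nonempty
  set e : Plane := EuclideanSpace.single 0 R.radius with he
  have hne : ‖e‖ = R.radius := by simp [he, hV.le]
  have he0 : e ≠ 0 := norm_pos_iff.1 (hne ▸ hV)
  -- Round robin: exactly one robot is active in each round.
  let act : ℕ → Set (Fin 3) := fun t => {i | i.val = t % 3}
  have hact : Scheduler.ssynch.Admits act := by
    refine ⟨fun t => ⟨⟨t % 3, Nat.mod_lt _ (by norm_num)⟩, rfl⟩, fun i t => ⟨3 * t + i, by omega, ?_⟩⟩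
    have := i.isLt
    simp only [act, Set.mem_ofPred_eq]
    omega
  have hconn : (visibilityGraph R.radius ![e, 0, -e]).Connected := by
    rw [SimpleGraph.connected_iff_exists_forall_reachable]
    refine ⟨1, fun i => ?_⟩
    by_cases hi : 1 = i
    · rw [hi]
    · refine SimpleGraph.Adj.reachable ⟨hi, ?_⟩
      fin_cases i <;> simp [hne] at hi ⊢
  have hinit : ![e, 0, -e] ∈ EqOsc.initial := by
    refine ⟨?_, ?_⟩
    · have h2 : (2 : ℝ) • e ≠ 0 := smul_ne_zero two_ne_zero he0
      rw [two_smul, Ne, add_eq_zero_iff_eq_neg] at h2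
      simpa using h2
    · simp [midpoint_eq_smul_add]
  obtain ⟨h1, h2, -⟩ := hP _ hinit hconn frame hframe act hact
  set run := P.run .full R.radius frame act ![e, 0, -e] with hrun
  have h0 : ∀ i, (run 0 i).1 = (![e, 0, -e] : Placement 3) i := fun _ => rfl
  simp only [h0, Matrix.cons_val] at h1 h2
  have hd : ∀ t, dist (run t 0).1 0 = R.radius := by
    intro t
    induction t with
    | zero => simpa [h0] using hne
    | succ t ih =>
      by_cases ht : t % 3 = 0
      · have : (2 : Fin 3) ∉ act t := by simp [act, ht]
        rw [(h1 (t + 1)).2, hrun, P.run_succ_of_notMem _ _ _ _ _ this, ← hrun, ← (h1 t).2, ih]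
      · have : (0 : Fin 3) ∉ act t := by simpa [act] using Ne.symm ht
        rw [hrun, P.run_succ_of_notMem _ _ _ _ _ this, ← hrun, ih]
  obtain ⟨t, -, ht, -⟩ := h2 0 (h0 0) (h0 2)
  have := hd t
  rw [ht] at this
  simp [AffineMap.lineMap_apply, norm_smul, hne] at this
  linarith

/-! ### `EqOsc` is solvable under `FSYNCH` with limited visibility -/

open Classical in
/-- Where a robot of `EqOsc` locates the middle robot, the set of positions observed being `S`: at
itself if it observes two opposite robots, and at the nearest other robot otherwise. -/
noncomputable def eqOscCentre (S : Set Plane) : Plane :=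
  if ∃ x ∈ S, x ≠ 0 ∧ -x ∈ S then 0
  else Classical.epsilon fun x => x ∈ S ∧ x ≠ 0 ∧ ∀ y ∈ S, y ≠ 0 → ‖x‖ ≤ ‖y‖

theorem eqOscCentre_of_neg_mem {S : Set Plane} {x : Plane} (hx : x ∈ S) (h0 : x ≠ 0)
    (hn : -x ∈ S) : eqOscCentre S = 0 :=
  if_pos ⟨x, hx, h0, hn⟩

/-- The case of an end robot, which may or may not see the opposite end, at `2 • m`. Nonzero
observed points are positive multiples of `m`, so no two are opposite, and `m` is strictly nearer
than `2 • m`. -/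
theorem eqOscCentre_of_subset {S : Set Plane} {m : Plane} (hm : m ∈ S) (h0 : m ≠ 0)
    (hS : ∀ x ∈ S, x = 0 ∨ x = m ∨ x = (2 : ℝ) • m) : eqOscCentre S = m := by
  have hpos := norm_pos_iff.2 h0
  have key : ∀ x ∈ S, x ≠ 0 → x = m ∨ x = (2 : ℝ) • m := fun x hx hx0 => (hS x hx).resolve_left hx0
  have hneg : ¬ ∃ x ∈ S, x ≠ 0 ∧ -x ∈ S := by
    rintro ⟨x, hx, hx0, hnx⟩
    obtain ⟨r, hr, rfl⟩ : ∃ r : ℝ, 0 < r ∧ x = r • m := by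
      rcases key x hx hx0 with h | h
      · exact ⟨1, one_pos, by rw [h, one_smul]⟩
      · exact ⟨2, two_pos, h⟩
    obtain ⟨s, hs, hsx⟩ : ∃ s : ℝ, 0 < s ∧ -(r • m) = s • m := by
      rcases key _ hnx (neg_ne_zero.2 hx0) with h | h
      · exact ⟨1, one_pos, by rw [h, one_smul]⟩
      · exact ⟨2, two_pos, h⟩
    have : (r + s) • m = 0 := by rw [add_smul, ← hsx, add_neg_cancel]
    rcases smul_eq_zero.1 this with h | h
    · linarith
    · exact h0 h
  rw [eqOscCentre, if_neg hneg]
  have hspec := Classical.epsilon_spec (p := fun x => x ∈ S ∧ x ≠ 0 ∧ ∀ y ∈ S, y ≠ 0 → ‖x‖ ≤ ‖y‖)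
    ⟨m, hm, h0, fun y hy hy0 => by
      rcases key y hy hy0 with rfl | rfl
      · exact le_rfl
      · rw [norm_smul, Real.norm_two]
        linarith⟩
  refine (key _ hspec.1 hspec.2.1).resolve_right fun h => ?_
  have := hspec.2.2 m hm h0
  rw [h, norm_smul, Real.norm_two] at this
  linarith

/-- The protocol for `EqOsc`: the light tells the parity of the round. -/
noncomputable def eqOscProtocol : Protocol where
  Color := Bool
  finite_color := inferInstance
  off := false
  -- Moving by 1/3 towards the centre scales distances by 2/3; moving by 1/2 away from it scales
  -- them by 3/2, the inverse.
  compute b S := ((if b then -(1 / 2) else 1 / 3 : ℝ) • eqOscCentre (Prod.fst '' S), !b)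

theorem eqOscCentre_snapshot {radius r : ℝ} (hr : 0 < r) {A w : Plane} (hw : w ≠ 0)
    (hrad : r * ‖w‖ ≤ radius) {C : Type} (b : C) (f : Frame) {c : Fin 3 → Plane × C}
    (hc : ∀ i, c i = (A + r • (![w, 0, -w] : Placement 3) i, b)) (i : Fin 3) :
    eqOscCentre (Prod.fst '' snapshot .limited radius f c i) = f.toLocal (c i).1 A := by
  have hrw : r • w ≠ 0 := smul_ne_zero hr.ne' hw
  have mem : ∀ j, dist (c i).1 (c j).1 ≤ radius →
      f.toLocal (c i).1 (c j).1 ∈ Prod.fst '' snapshot .limited radius f c i :=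
    fun j hj => ⟨_, ⟨j, hj, rfl⟩, rfl⟩
  have hA : (c 1).1 = A := by simp [hc]
  have hdist : dist (c i).1 A ≤ radius := by
    have h0 : 0 ≤ radius := le_trans (by positivity) hrad
    rw [hc]
    fin_cases i <;> simp [norm_smul, abs_of_pos hr, h0, hrad]
  by_cases hi : i = 1
  · subst hi
    have h0 := mem 0 (by rw [dist_comm, hA, hc]; simpa [norm_smul, abs_of_pos hr] using hrad)
    have h2 := mem 2 (by rw [dist_comm, hA, hc]; simpa [norm_smul, abs_of_pos hr] using hrad)
    rw [hA] at h0 h2 ⊢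
    rw [f.toLocal_self]
    refine eqOscCentre_of_neg_mem h0 ?_ ?_
    · rw [Ne, f.toLocal_eq_zero_iff]
      simpa [hc] using hrw
    · convert h2 using 1
      simp [hc, Frame.toLocal]
  · refine eqOscCentre_of_subset (by simpa [hA] using mem 1 (by rwa [hA])) ?_ ?_
    · rw [Ne, f.toLocal_eq_zero_iff, hc]
      fin_cases i <;> simp [hr.ne', hw] at hi ⊢
    · rintro _ ⟨_, ⟨j, -, rfl⟩, rfl⟩
      have h2 : ∀ x : Plane, (2 : ℝ) • f.toLocal x A = f.toLocal x (x + (2 : ℝ) • (A - x)) := by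
        intro x
        rw [f.toLocal_add_smul, add_sub_cancel]
      have key : (c j).1 = (c i).1 ∨ (c j).1 = A ∨
          (c j).1 = (c i).1 + (2 : ℝ) • (A - (c i).1) := by
        simp only [hc]
        fin_cases i <;> fin_cases j <;> simp at hi ⊢
        · right; right; module
        · right; right; module
      rcases key with h | h | h
      · left; rw [h, f.toLocal_self]
      · right; left; rw [h]
      · right; right; rw [h2, ← h]

theorem run_eqOscProtocol {radius : ℝ} {frame : ℕ → Fin 3 → Frame} {act : ℕ → Set (Fin 3)}
    (hact : ∀ t, act t = Set.univ) {A w : Plane} (hw : w ≠ 0) (hrad : ‖w‖ ≤ radius)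
    {c₀ : Placement 3} (hc₀ : ∀ i, c₀ i = A + (![w, 0, -w] : Placement 3) i) (k : ℕ) :
    (∀ i, eqOscProtocol.run .limited radius frame act c₀ (2 * k) i =
      (A + (1 : ℝ) • (![w, 0, -w] : Placement 3) i, false)) ∧
    (∀ i, eqOscProtocol.run .limited radius frame act c₀ (2 * k + 1) i =
      (A + (2 / 3 : ℝ) • (![w, 0, -w] : Placement 3) i, true)) := by
  have step : ∀ t (r : ℝ) (b : Bool), 0 < r → r ≤ 1 →
      (∀ i, eqOscProtocol.run .limited radius frame act c₀ t i =
        (A + r • (![w, 0, -w] : Placement 3) i, b)) → ∀ i,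
      eqOscProtocol.run .limited radius frame act c₀ (t + 1) i =
        (A + ((1 - if b then -(1 / 2) else 1 / 3 : ℝ) * r) • (![w, 0, -w] : Placement 3) i, !b) := by
    intro t r b hr hr1 h i
    have hrad' : r * ‖w‖ ≤ radius :=
      (mul_le_of_le_one_left (norm_nonneg w) hr1).trans hrad
    have hcentre := eqOscCentre_snapshot hr hw hrad' b (frame t i) h i
    rw [Protocol.run_succ_of_mem _ _ _ _ _ _ (by rw [hact]; trivial)]
    simp only [eqOscProtocol] at hcentre h ⊢
    rw [hcentre, Frame.toGlobal_smul_toLocal, h]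
    ext1
    · dsimp only
      module
    · rfl
  have odd : ∀ k, (∀ i, eqOscProtocol.run .limited radius frame act c₀ (2 * k) i =
      (A + (1 : ℝ) • (![w, 0, -w] : Placement 3) i, false)) →
      ∀ i, eqOscProtocol.run .limited radius frame act c₀ (2 * k + 1) i =
      (A + (2 / 3 : ℝ) • (![w, 0, -w] : Placement 3) i, true) := by
    intro k h i
    rw [step _ _ _ one_pos le_rfl h]
    norm_num
    rfl
  induction k with
  | zero =>
    have h : ∀ i, eqOscProtocol.run .limited radius frame act c₀ (2 * 0) i =
      (A + (1 : ℝ) • (![w, 0, -w] : Placement 3) i, false) := by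
      intro i
      rw [one_smul, ← hc₀]
      rfl
    exact ⟨h, odd 0 h⟩
  | succ k ih =>
    have h : ∀ i, eqOscProtocol.run .limited radius frame act c₀ (2 * (k + 1)) i =
        (A + (1 : ℝ) • (![w, 0, -w] : Placement 3) i, false) := by
      intro i
      rw [show 2 * (k + 1) = 2 * k + 1 + 1 by ring,
        step _ _ _ (by norm_num) (by norm_num) ih.2]
      norm_num
      rfl
    exact ⟨h, odd _ h⟩

theorem eqOsc_mem_fsynch_limited (R : Team 3) : EqOsc ∈ LUMI .fsynch .limited 3 R := by
  refine ⟨eqOscProtocol, fun c₀ hc₀ hconn frame _ act hact => ?_⟩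
  obtain ⟨hne, hmid⟩ := hc₀
  set A := c₀ 1 with hA
  set w := c₀ 0 - A with hwdef
  have hc2 : c₀ 2 = A - w := by
    rw [hwdef, hmid, midpoint_eq_smul_add, invOf_eq_inv]
    module
  have hc0 : c₀ 0 = A + w := by simp [hwdef]
  have hw : w ≠ 0 := fun h => hne (by rw [hc0, hc2, h]; simp)
  have hc : ∀ i, c₀ i = A + (![w, 0, -w] : Placement 3) i := by
    intro i
    fin_cases i
    · simpa using hc0
    · simp [hA]
    · simpa [← sub_eq_add_neg] using hc2
  -- By connectedness the middle robot has a neighbour, and both ends are at distance `‖w‖` from it.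
  have hrad : ‖w‖ ≤ R.radius := by
    obtain ⟨j, hj⟩ := hconn.preconnected.exists_adj_of_nontrivial 1
    have := hj.2
    rw [hc 1, hc j] at this
    have hj1 := hj.1
    fin_cases j <;> simp at this hj1 <;> exact this
  have hrun := run_eqOscProtocol (frame := frame) hact hw hrad hc
  have heven : ∀ k i, (eqOscProtocol.run .limited R.radius frame act c₀ (2 * k) i).1 = c₀ i := by
    intro k i
    rw [(hrun k).1, hc, one_smul]
  have hodd : ∀ k i, (eqOscProtocol.run .limited R.radius frame act c₀ (2 * k + 1) i).1 =
      AffineMap.lineMap A (c₀ i) (2 / 3 : ℝ) := by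
    intro k i
    rw [(hrun k).2, hc, AffineMap.lineMap_apply]
    simp [add_comm]
  have hz : ∀ i, (eqOscProtocol.run .limited R.radius frame act c₀ 0 i).1 = c₀ i := fun _ => rfl
  -- Odd rounds are contracted and even rounds are initial, so `2 * t + 1` and `2 * (t + 1)` serve
  -- as later rounds for every `t`.
  refine ⟨fun t => ?_, fun t _ _ => ⟨2 * t + 1, by omega, ?_, ?_⟩,
    fun t _ _ => ⟨2 * (t + 1), by omega, ?_, ?_⟩⟩
  · simp only [hz]
    rcases Nat.even_or_odd' t with ⟨k, rfl | rfl⟩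
    · simp only [heven, ← hA, hc0, hc2, true_and]
      simp
    · simp only [hodd, ← hA, hc0, hc2, AffineMap.lineMap_apply]
      simp
  · simp only [hodd, hz, ← hA]
  · simp only [hodd, hz, ← hA]
  · simp only [heven, hz]
  · simp only [heven, hz]

/-! ### `AE` is solvable under `SSYNCH` with full visibility -/

open scoped RealInnerProductSpace

theorem inner_pos_of_angle_lt_pi_div_two {x y : Plane}
    (h : InnerProductGeometry.angle x y < Real.pi / 2) : 0 < ⟪x, y⟫ := by
  rw [← InnerProductGeometry.cos_angle_mul_norm_mul_norm]
  -- The angle with the zero vector is π/2 by convention, so a smaller angle excludes it.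
  have hx : x ≠ 0 := by rintro rfl; simp at h
  have hy : y ≠ 0 := by rintro rfl; simp at h
  have := Real.cos_pos_of_mem_Ioo
    ⟨by linarith [InnerProductGeometry.angle_nonneg x y, Real.pi_pos], h⟩
  positivity

theorem inner_pos_of_extAngle_lt {X Y Z : Plane} (h : extAngle X Y Z < Real.pi / 2) :
    0 < ⟪X - Y, Y - Z⟫ :=
  inner_pos_of_angle_lt_pi_div_two h

theorem IsOpenPath.lt {c : Placement 4} (h : IsOpenPath c) :
    (dist (c 0) (c 1) < dist (c 0) (c 2) ∧ dist (c 0) (c 1) < dist (c 1) (c 3) ∧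
      dist (c 0) (c 1) < dist (c 0) (c 3)) ∧
    (dist (c 1) (c 2) < dist (c 0) (c 2) ∧ dist (c 1) (c 2) < dist (c 1) (c 3) ∧
      dist (c 1) (c 2) < dist (c 0) (c 3)) ∧
    (dist (c 2) (c 3) < dist (c 0) (c 2) ∧ dist (c 2) (c 3) < dist (c 1) (c 3) ∧
      dist (c 2) (c 3) < dist (c 0) (c 3)) := by
  simpa [IsOpenPath] using h

/-! ### Recognizing the robots in an initial placement -/

theorem injective_of_mem_initial {c : Placement 4} (h : c ∈ AE.initial) : Function.Injective c := by
  obtain ⟨-, h12, h2, hp⟩ := h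
  obtain ⟨⟨h02, h13, h03⟩, -⟩ := hp.lt
  have hi1 := inner_pos_of_extAngle_lt (h12.trans h2)
  have hi2 := inner_pos_of_extAngle_lt h2
  have n01 : c 0 ≠ c 1 := fun h => by simp [h] at hi1
  have n12 : c 1 ≠ c 2 := fun h => by simp [h] at hi1
  have n23 : c 2 ≠ c 3 := fun h => by simp [h] at hi2
  have n02 : c 0 ≠ c 2 := dist_pos.1 (dist_nonneg.trans_lt h02)
  have n13 : c 1 ≠ c 3 := dist_pos.1 (dist_nonneg.trans_lt h13)
  have n03 : c 0 ≠ c 3 := dist_pos.1 (dist_nonneg.trans_lt h03)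
  intro i j hij
  fin_cases i <;> fin_cases j <;> simp_all [eq_comm]

theorem toLocal_mem_initial {c : Placement 4} (h : c ∈ AE.initial) (f : Frame) (p : Plane) :
    (fun i => f.toLocal p (c i)) ∈ AE.initial := by
  obtain ⟨h1, h12, h2, hp⟩ := h
  have hp := hp.lt
  refine ⟨?_, ?_, ?_, ?_⟩
  · simpa only [f.extAngle_toLocal]
  · simpa only [f.extAngle_toLocal]
  · simpa only [f.extAngle_toLocal]
  · simpa [IsOpenPath, f.dist_toLocal, f.scale_pos] using hp

/-- The only injections of the path `0 1 2 3` preserving adjacency and non-adjacency in the sense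
below are the identity and the reversal. -/
theorem path_rigid : ∀ σ : Fin 4 → Fin 4, Function.Injective σ →
    σ = id ∨ σ = Fin.rev ∨ ∃ i j k l : Fin 4, (i.val + 1 = j ∧ k.val + 1 < l) ∧
      ((σ i).val + 1 < σ j ∨ (σ j).val + 1 < σ i) ∧
      ((σ k).val + 1 = σ l ∨ (σ l).val + 1 = σ k) := by
  decide +kernel

theorem IsOpenPath.dist_lt {c : Placement 4} (h : IsOpenPath c) {i j k l : Fin 4}
    (hij : i.val + 1 = j) (hkl : k.val + 1 < l) : dist (c i) (c j) < dist (c k) (c l) := by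
  have := h.lt
  fin_cases i <;> fin_cases j <;> simp at hij <;>
    fin_cases k <;> fin_cases l <;> simp at hkl <;> simp_all

/-- By `path_rigid` a relabelling is the identity, the reversal, or exchanges some consecutive pair
for a non-consecutive one and vice versa. The reversal swaps θ₁ and θ₂, against θ₁ < θ₂; the
exchange contradicts the comparison of distances. -/
theorem initial_labelling_unique {X Y : Placement 4} (hX : X ∈ AE.initial) (hY : Y ∈ AE.initial)
    (h : Set.range Y ⊆ Set.range X) : Y = X := by
  choose σ hσ using fun i => h ⟨i, rfl⟩
  have hinj : Function.Injective σ := fun i j hij => injective_of_mem_initial hY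
    (by rw [← hσ i, ← hσ j, hij])
  rcases path_rigid σ hinj with rfl | rfl | ⟨i, j, k, l, ⟨hij, hkl⟩, hσij, hσkl⟩
  · exact funext fun i => (hσ i).symm
  · have h12 := hX.2.1
    have h12' := hY.2.1
    simp only [← hσ] at h12 h12'
    exact absurd h12' h12.not_gt
  · have h1 := hY.2.2.2.dist_lt hij hkl
    have h2 : dist (X (σ k)) (X (σ l)) < dist (X (σ i)) (X (σ j)) := by
      rcases hσij with h | h <;> rcases hσkl with h' | h'
      · exact hX.2.2.2.dist_lt h' h
      · rw [dist_comm (X (σ k))]; exact hX.2.2.2.dist_lt h' h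
      · rw [dist_comm (X (σ i))]; exact hX.2.2.2.dist_lt h' h
      · rw [dist_comm (X (σ k)), dist_comm (X (σ i))]; exact hX.2.2.2.dist_lt h' h
    rw [hσ, hσ, hσ, hσ] at h2
    exact absurd h1 h2.not_gt

open Classical in
/-- The protocol for `AE`: when all lights are off, the robot `r₁` moves to the point reflection of
`r₄` at the midpoint of `r₂` and `r₃`, and switches its light on. -/
noncomputable def aeProtocol : Protocol where
  Color := Bool
  finite_color := inferInstance
  off := false
  compute b S :=
    -- `X 0 = 0` says that the observer is r₁. The choice of `X` is harmless, since the labelling is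
    -- unique.
    if h : ∃ X : Placement 4, X ∈ AE.initial ∧ X 0 = 0 ∧ S = Set.range fun j => (X j, false) then
      (h.choose 1 + h.choose 2 - h.choose 3, true)
    else (0, b)

/-- The placement reached from `c` by `aeProtocol`. -/
noncomputable def aeTarget (c : Placement 4) : Placement 4 :=
  ![c 1 + c 2 - c 3, c 1, c 2, c 3]

/-! ### Execution of the protocol for `AE` -/

theorem snapshot_full_eq_range {n : ℕ} {C : Type} (radius : ℝ) (f : Frame)
    (c : Fin n → Plane × C) (i : Fin n) :
    snapshot .full radius f c i = Set.range fun j => (f.toLocal (c i).1 (c j).1, (c j).2) := by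
  ext q
  simp [snapshot, Visibility.Sees, eq_comm]

theorem aeProtocol_compute_mover {c : Placement 4} (hc : c ∈ AE.initial) (radius : ℝ) (f : Frame) :
    aeProtocol.compute false (snapshot .full radius f (fun j => (c j, false)) 0) =
      (f.toLocal (c 0) (c 1) + f.toLocal (c 0) (c 2) - f.toLocal (c 0) (c 3), true) := by
  have hX := toLocal_mem_initial hc f (c 0)
  have h : ∃ X : Placement 4, X ∈ AE.initial ∧ X 0 = 0 ∧
      snapshot .full radius f (fun j => (c j, false)) 0 = Set.range fun j => (X j, false) :=
    ⟨_, hX, f.toLocal_self _, snapshot_full_eq_range ..⟩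
  simp only [aeProtocol]
  rw [dif_pos h]
  have hspec := h.choose_spec
  have heq : h.choose = fun i => f.toLocal (c 0) (c i) := by
    refine initial_labelling_unique hX hspec.1 ?_
    have := congrArg (Prod.fst '' ·) (hspec.2.2.symm.trans (snapshot_full_eq_range ..))
    simp only [← Set.range_comp] at this
    exact this.le
  simp only [heq]

theorem aeProtocol_compute_other {c : Placement 4} (hc : c ∈ AE.initial) (radius : ℝ) (f : Frame)
    {i : Fin 4} (hi : i ≠ 0) :
    aeProtocol.compute false (snapshot .full radius f (fun j => (c j, false)) i) = (0, false) := by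
  have hX := toLocal_mem_initial hc f (c i)
  simp only [aeProtocol]
  rw [dif_neg]
  rintro ⟨X, hX', h0, hS⟩
  have heq : X = fun j => f.toLocal (c i) (c j) := by
    refine initial_labelling_unique hX hX' ?_
    have := congrArg (Prod.fst '' ·) (hS.symm.trans (snapshot_full_eq_range ..))
    simp only [← Set.range_comp] at this
    exact this.le
  rw [heq, f.toLocal_eq_zero_iff] at h0
  exact hi (injective_of_mem_initial hc h0).symm

theorem aeProtocol_compute_done {n : ℕ} {c : Fin n → Plane × Bool} {k : Fin n}
    (hk : (c k).2 = true) (radius : ℝ) (f : Frame) (b : Bool) (i : Fin n) :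
    aeProtocol.compute b (snapshot .full radius f c i) = (0, b) := by
  simp only [aeProtocol]
  rw [dif_neg]
  rintro ⟨X, -, -, hS⟩
  have : (f.toLocal (c i).1 (c k).1, (c k).2) ∈ Set.range fun j => (X j, false) := by
    rw [← hS, snapshot_full_eq_range]
    exact ⟨k, rfl⟩
  obtain ⟨j, hj⟩ := this
  rw [hk] at hj
  exact Bool.noConfusion (congrArg Prod.snd hj)

/-- Here `s` is the first round in which r₁ is active, so its jump shows from round `s + 1` on. Its
light then stops every robot for good. -/
theorem run_aeProtocol {c₀ : Placement 4} (hc : c₀ ∈ AE.initial) (radius : ℝ)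
    (frame : ℕ → Fin 4 → Frame) {act : ℕ → Set (Fin 4)} {s : ℕ} (hs : 0 ∈ act s)
    (hmin : ∀ t < s, 0 ∉ act t) (t : ℕ) :
    (t ≤ s → aeProtocol.run .full radius frame act c₀ t = fun i => (c₀ i, false)) ∧
    (s < t → aeProtocol.run .full radius frame act c₀ t =
      fun i => (aeTarget c₀ i, decide (i = 0))) := by
  have stay : ∀ t, t ≤ s → ∀ i, (i ≠ 0 ∨ t < s) →
      aeProtocol.run .full radius frame act c₀ t = (fun i => (c₀ i, false)) →
      aeProtocol.run .full radius frame act c₀ (t + 1) i = (c₀ i, false) := by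
    intro t ht i hi h
    by_cases hact : i ∈ act t
    · have hi0 : i ≠ 0 := hi.elim id fun h => by rintro rfl; exact hmin t h hact
      have := aeProtocol_compute_other hc radius (frame t i) hi0
      rw [Protocol.run_succ_of_mem _ _ _ _ _ _ hact, h]
      simp only [aeProtocol] at this ⊢
      rw [this, Frame.toGlobal_zero]
    · rw [Protocol.run_succ_of_notMem _ _ _ _ _ _ hact, h]
  induction t with
  | zero => exact ⟨fun _ => rfl, fun h => absurd h (Nat.not_lt_zero _)⟩
  | succ t ih =>
    refine ⟨fun ht => funext fun i => stay t (by omega) i (.inr ht) (ih.1 (by omega)),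
      fun ht => funext fun i => ?_⟩
    rcases (Nat.lt_succ_iff.1 ht).eq_or_lt with rfl | hlt
    · have h := ih.1 le_rfl
      by_cases hi : i = 0
      · subst hi
        have hcomp := aeProtocol_compute_mover hc radius (frame s 0)
        rw [Protocol.run_succ_of_mem _ _ _ _ _ _ hs, h]
        simp only [aeProtocol] at hcomp ⊢
        rw [hcomp]
        -- The coefficients 1, 1, -1 sum to 1, so the combination is affine and commutes with the
        -- change of coordinates.
        have : (frame s 0).toLocal (c₀ 0) (c₀ 1) + (frame s 0).toLocal (c₀ 0) (c₀ 2) -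
            (frame s 0).toLocal (c₀ 0) (c₀ 3) =
            (1 : ℝ) • (frame s 0).toLocal (c₀ 0) (c₀ 1 + c₀ 2 - c₀ 3) := by
          rw [one_smul]
          simp only [Frame.toLocal, ← smul_add, ← smul_sub, ← map_add, ← map_sub]
          congr 2
          abel
        rw [this, Frame.toGlobal_smul_toLocal]
        simp [aeTarget]
      · rw [stay s le_rfl i (.inl hi) h]
        fin_cases i <;> simp [aeTarget] at hi ⊢ <;> rfl
    · have h := ih.2 hlt
      by_cases hact : i ∈ act t
      · have hcomp := aeProtocol_compute_done (c := fun i => (aeTarget c₀ i, decide (i = 0)))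
          (k := 0) rfl radius (frame t i) (decide (i = 0)) i
        rw [Protocol.run_succ_of_mem _ _ _ _ _ _ hact, h]
        simp only [aeProtocol] at hcomp ⊢
        rw [hcomp, Frame.toGlobal_zero]
      · rw [Protocol.run_succ_of_notMem _ _ _ _ _ _ hact, h]

/-! ### Angles and absence of collisions in the jump -/

theorem extAngle_add_sub (B C D : Plane) : extAngle (B + C - D) B C = extAngle D C B := by
  rw [extAngle, extAngle, ← InnerProductGeometry.angle_neg_neg]
  congr 1 <;> abel

theorem mem_segment_inner_pos {X Y B u : Plane} (hX : 0 < ⟪X - B, u⟫) (hY : 0 < ⟪Y - B, u⟫)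
    {Z : Plane} (hZ : Z ∈ segment ℝ X Y) : 0 < ⟪Z - B, u⟫ := by
  obtain ⟨a, b, ha, hb, hab, rfl⟩ := hZ
  have : a • X + b • Y - B = a • (X - B) + b • (Y - B) := by
    obtain rfl : a = 1 - b := by linarith
    module
  rw [this, inner_add_left, inner_smul_left, inner_smul_left]
  simp only [conj_trivial]
  rcases ha.eq_or_lt with rfl | ha
  · rw [zero_add] at hab
    subst hab
    simpa using hY
  · have := mul_pos ha hX
    have := mul_nonneg hb hY.le
    linarith

/-- The line through B perpendicular to BC separates: the path of r₁ lies strictly beyond it, and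
the other three robots lie on it or behind it. -/
theorem disjoint_segment_aeTarget {c : Placement 4} (hc : c ∈ AE.initial) {X Y : Plane}
    (hX : 0 < ⟪X - c 1, c 1 - c 2⟫) (hY : 0 < ⟪Y - c 1, c 1 - c 2⟫) {j : Fin 4} (hj : j ≠ 0) :
    Disjoint (segment ℝ X Y) (segment ℝ (c j) (c j)) := by
  have h3 := inner_pos_of_extAngle_lt hc.2.2.1
  rw [segment_same, Set.disjoint_singleton_right]
  intro hmem
  have hpos := mem_segment_inner_pos hX hY hmem
  have hnn : 0 ≤ ⟪c 1 - c 2, c 1 - c 2⟫ := real_inner_self_nonneg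
  fin_cases j
  · exact hj rfl
  · simp at hpos
  · have : ⟪c 2 - c 1, c 1 - c 2⟫ = -⟪c 1 - c 2, c 1 - c 2⟫ := by
      rw [← inner_neg_left, neg_sub]
    simp only [Fin.reduceFinMk] at hpos
    linarith
  · have h : ⟪c 3 - c 1, c 1 - c 2⟫ = -⟪c 3 - c 2, c 2 - c 1⟫ - ⟪c 1 - c 2, c 1 - c 2⟫ := by
      rw [← inner_neg_right, neg_sub, ← inner_sub_left]
      congr 1
      abel
    simp only [Fin.reduceFinMk] at hpos
    linarith

theorem mem_ae_valid_of_jump {c₀ : Placement 4} (hc : c₀ ∈ AE.initial) {c : ℕ → Placement 4} {s : ℕ}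
    (hle : ∀ t ≤ s, c t = c₀) (hgt : ∀ t, s < t → c t = aeTarget c₀) : c ∈ AE.valid := by
  have hA := inner_pos_of_extAngle_lt (hc.2.1.trans hc.2.2.1)
  have hang : extAngle (aeTarget c₀ 0) (c₀ 1) (c₀ 2) = extAngle (c₀ 3) (c₀ 2) (c₀ 1) :=
    extAngle_add_sub ..
  have hA' := inner_pos_of_extAngle_lt (hang.trans_lt hc.2.2.1)
  have hcons : ∀ i, i ≠ 0 → aeTarget c₀ i = c₀ i := by
    intro i hi
    fin_cases i <;> simp [aeTarget] at hi ⊢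
  have hoff : ∀ t i, i ≠ 0 → c t i = c₀ i := by
    intro t i hi
    rcases le_or_gt t s with h | h
    · rw [hle t h]
    · rw [hgt t h, hcons i hi]
  have hpos : ∀ t, 0 < ⟪c t 0 - c₀ 1, c₀ 1 - c₀ 2⟫ := by
    intro t
    rcases le_or_gt t s with h | h
    · rwa [hle t h]
    · rwa [hgt t h]
  have h0 := hle 0 (Nat.zero_le s)
  refine ⟨fun t i j hij => ?_, s + 1, fun t ht => ?_, ?_, fun t ht => ?_⟩
  · by_cases hi : i = 0
    · subst hi
      rw [hoff t j hij.symm, hoff (t + 1) j hij.symm]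
      exact disjoint_segment_aeTarget hc (hpos t) (hpos (t + 1)) hij.symm
    · rw [hoff t i hi, hoff (t + 1) i hi]
      by_cases hj : j = 0
      · subst hj
        exact (disjoint_segment_aeTarget hc (hpos t) (hpos (t + 1)) hij).symm
      · rw [hoff t j hj, hoff (t + 1) j hj]
        simpa using (injective_of_mem_initial hc).ne hij
  · rw [h0, hle t (by omega)]
    exact ⟨rfl, rfl, rfl, rfl⟩
  · rw [h0, hgt (s + 1) (by omega)]
    exact ⟨rfl, rfl, hang, rfl⟩
  · rw [hgt (s + 1) (by omega)]
    exact hgt t (by omega)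

theorem ae_mem_ssynch_full (R : Team 4) : AE ∈ LUMI .ssynch .full 4 R := by
  classical
  refine ⟨aeProtocol, fun c₀ hc _ frame _ act hact => ?_⟩
  have hex : ∃ s, 0 ∈ act s := (hact.2 0 0).imp fun _ h => h.2
  have hrun := run_aeProtocol hc R.radius frame (Nat.find_spec hex) (fun t => Nat.find_min hex)
  exact mem_ae_valid_of_jump (s := Nat.find hex) hc (fun t ht => by simp only [(hrun t).1 ht])
    (fun t ht => by simp only [(hrun t).2 ht])

/-! ### `AE` is not solvable under `FSYNCH` with limited visibility -/

theorem norm_lt_of_sq_lt_inner {x u : Plane} (h : ‖u‖ ^ 2 < ⟪x, u⟫) : ‖u‖ < ‖x‖ := by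
  have := real_inner_le_norm x u
  by_contra! hle
  nlinarith [norm_nonneg u, mul_le_mul_of_nonneg_right hle (norm_nonneg u)]

/-- In the direction of BC, the projection of each of the three vectors is longer than BC;
Cauchy–Schwarz concludes. -/
theorem dist_lt_of_acute {X B C W : Plane} (hX : 0 < ⟪X - B, B - C⟫) (hW : 0 < ⟪W - C, C - B⟫) :
    dist B C < dist X C ∧ dist B C < dist B W ∧ dist B C < dist X W := by
  have hu : ⟪B - C, B - C⟫ = ‖B - C‖ ^ 2 := real_inner_self_eq_norm_sq _
  have hW' : ⟪C - W, B - C⟫ = ⟪W - C, C - B⟫ := by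
    rw [← inner_neg_neg, neg_sub, neg_sub]
  simp only [dist_eq_norm]
  refine ⟨norm_lt_of_sq_lt_inner ?_, norm_lt_of_sq_lt_inner ?_, norm_lt_of_sq_lt_inner ?_⟩
  · rw [← sub_add_sub_cancel X B C, inner_add_left]
    linarith
  · rw [← sub_add_sub_cancel B C W, inner_add_left]
    linarith
  · rw [← sub_add_sub_cancel X B W, ← sub_add_sub_cancel B C W, inner_add_left, inner_add_left]
    linarith

/-- Among four robots, those on non-consecutive positions of the path `0 1 2 3` are too far from
each other to be observed with the given radius. -/
def Separated {C : Type} (radius : ℝ) (c : Fin 4 → Plane × C) : Prop :=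
  radius < dist (c 0).1 (c 2).1 ∧ radius < dist (c 1).1 (c 3).1 ∧ radius < dist (c 0).1 (c 3).1

theorem separated_of_hasAngles {Col : Type} {c : Fin 4 → Plane × Col} {B C : Plane} {α β : ℝ}
    (h : HasAngles B C α β fun i => (c i).1) (hα : α < Real.pi / 2) (hβ : β < Real.pi / 2) :
    Separated (dist B C) c := by
  obtain ⟨h1, h2, hα', hβ'⟩ := h
  have := dist_lt_of_acute (inner_pos_of_extAngle_lt (hα'.trans_lt hα))
    (inner_pos_of_extAngle_lt (hβ'.trans_lt hβ))
  simpa only [Separated, h1, h2] using this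

/-! ### Flow of information along the path -/

theorem snapshot_limited_congr {n : ℕ} {C : Type} {radius : ℝ} (f : Frame)
    {c c' : Fin n → Plane × C} {i : Fin n} (hi : c i = c' i)
    (h : ∀ j, c j = c' j ∨ radius < dist (c i).1 (c j).1 ∧ radius < dist (c' i).1 (c' j).1) :
    snapshot .limited radius f c i = snapshot .limited radius f c' i := by
  ext q
  refine exists_congr fun j => ?_
  rcases h j with h | ⟨h, h'⟩
  · rw [hi, h]
  · exact iff_of_false (fun hs => h.not_ge hs.1) (fun hs => h'.not_ge hs.1)

/-- Everything that r₁ and r₂ learn about r₄ passes through r₃. Agreement of r₃ before `T` gives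
agreement of r₁ and r₂ up to `T` inclusive, because round `T` is computed from the snapshots of
round `T - 1`. -/
theorem run_eq_of_separated (P : Protocol) {radius : ℝ} {frame : ℕ → Fin 4 → Frame}
    {act : ℕ → Set (Fin 4)} (hact : ∀ t, act t = Set.univ) {c₀ c₀' : Placement 4}
    (h0 : c₀ 0 = c₀' 0) (h1 : c₀ 1 = c₀' 1) {T : ℕ}
    (h2 : ∀ t < T, P.run .limited radius frame act c₀ t 2 = P.run .limited radius frame act c₀' t 2)
    (hs : ∀ t < T, Separated radius (P.run .limited radius frame act c₀ t))
    (hs' : ∀ t < T, Separated radius (P.run .limited radius frame act c₀' t)) :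
    ∀ t ≤ T, P.run .limited radius frame act c₀ t 0 = P.run .limited radius frame act c₀' t 0 ∧
      P.run .limited radius frame act c₀ t 1 = P.run .limited radius frame act c₀' t 1 := by
  intro t
  induction t with
  | zero => exact fun _ => ⟨Prod.ext h0 rfl, Prod.ext h1 rfl⟩
  | succ t ih =>
    intro ht
    obtain ⟨ih0, ih1⟩ := ih (by omega)
    have h2 := h2 t ht
    obtain ⟨-, s13, s03⟩ := hs t ht
    obtain ⟨-, s13', s03'⟩ := hs' t ht
    have snap : ∀ i : Fin 4, i = 0 ∨ i = 1 →
        snapshot .limited radius (frame t i) (P.run .limited radius frame act c₀ t) i =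
          snapshot .limited radius (frame t i) (P.run .limited radius frame act c₀' t) i := by
      rintro i (rfl | rfl)
      · refine snapshot_limited_congr _ ih0 fun j => ?_
        fin_cases j
        exacts [.inl ih0, .inl ih1, .inl h2, .inr ⟨s03, s03'⟩]
      · refine snapshot_limited_congr _ ih1 fun j => ?_
        fin_cases j
        exacts [.inl ih0, .inl ih1, .inl h2, .inr ⟨s13, s13'⟩]
    have hmem : ∀ i, i ∈ act t := fun i => by rw [hact]; trivial
    constructor
    · rw [P.run_succ_of_mem _ _ _ _ _ (hmem 0), P.run_succ_of_mem _ _ _ _ _ (hmem 0),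
        snap 0 (.inl rfl), ih0]
    · rw [P.run_succ_of_mem _ _ _ _ _ (hmem 1), P.run_succ_of_mem _ _ _ _ _ (hmem 1),
        snap 1 (.inr rfl), ih1]

/-- A placement of `AE` with `AB = BC = CD = V`, `θ₁ = π / 4` and `θ₂ = θ`. -/
noncomputable def equilateralPath (V θ : ℝ) : Placement 4 :=
  ![V • !₂[Real.cos (Real.pi / 4), Real.sin (Real.pi / 4)], 0, -(V • !₂[1, 0]),
    -(V • !₂[1, 0]) + V • !₂[-Real.cos θ, Real.sin θ]]

/-! ### Equilateral paths are initial placements of `AE` -/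

theorem norm_cos_sin (θ : ℝ) : ‖(!₂[Real.cos θ, Real.sin θ] : Plane)‖ = 1 := by
  simp [EuclideanSpace.norm_eq, Fin.sum_univ_two]

theorem norm_neg_cos_sin (θ : ℝ) : ‖(!₂[-Real.cos θ, Real.sin θ] : Plane)‖ = 1 := by
  simp [EuclideanSpace.norm_eq, Fin.sum_univ_two]

theorem norm_one_zero : ‖(!₂[1, 0] : Plane)‖ = 1 := by
  simp [EuclideanSpace.norm_eq, Fin.sum_univ_two]

theorem extAngle_equilateralPath_left {V : ℝ} (hV : 0 < V) (θ : ℝ) :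
    extAngle (equilateralPath V θ 0) (equilateralPath V θ 1) (equilateralPath V θ 2) =
      Real.pi / 4 := by
  have : extAngle (equilateralPath V θ 0) (equilateralPath V θ 1) (equilateralPath V θ 2) =
      InnerProductGeometry.angle (V • !₂[Real.cos (Real.pi / 4), Real.sin (Real.pi / 4)] : Plane)
        (V • !₂[1, 0]) := by
    simp [extAngle, equilateralPath]
  rw [this, InnerProductGeometry.angle_smul_smul hV.ne', InnerProductGeometry.angle, norm_cos_sin,
    norm_one_zero, EuclideanSpace.inner_eq_star_dotProduct]
  conv_rhs => rw [← Real.arccos_cos (x := Real.pi / 4) (by positivity) (by linarith [Real.pi_pos])]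
  simp [-Real.cos_pi_div_four, -Real.sin_pi_div_four]

theorem extAngle_equilateralPath_right {V θ : ℝ} (hV : 0 < V) (h0 : 0 ≤ θ) (hpi : θ ≤ Real.pi) :
    extAngle (equilateralPath V θ 3) (equilateralPath V θ 2) (equilateralPath V θ 1) = θ := by
  have : extAngle (equilateralPath V θ 3) (equilateralPath V θ 2) (equilateralPath V θ 1) =
      InnerProductGeometry.angle (V • !₂[-Real.cos θ, Real.sin θ] : Plane) (V • -!₂[1, 0]) := by
    simp [extAngle, equilateralPath]
  rw [this, InnerProductGeometry.angle_smul_smul hV.ne', InnerProductGeometry.angle,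
    norm_neg, norm_neg_cos_sin, norm_one_zero, EuclideanSpace.inner_eq_star_dotProduct]
  conv_rhs => rw [← Real.arccos_cos h0 hpi]
  simp

theorem dist_equilateralPath {V : ℝ} (hV : 0 < V) (θ : ℝ) :
    dist (equilateralPath V θ 0) (equilateralPath V θ 1) = V ∧
    dist (equilateralPath V θ 1) (equilateralPath V θ 2) = V ∧
    dist (equilateralPath V θ 2) (equilateralPath V θ 3) = V := by
  refine ⟨?_, ?_, ?_⟩
  · rw [dist_eq_norm]
    simp [-Real.cos_pi_div_four, -Real.sin_pi_div_four, equilateralPath, norm_smul, norm_cos_sin,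
      hV.le]
  · rw [dist_eq_norm]
    simp [equilateralPath, norm_smul, norm_one_zero, hV.le]
  · rw [dist_eq_norm]
    simp [equilateralPath, norm_smul, norm_neg_cos_sin, hV.le]

theorem equilateralPath_mem_initial {V θ : ℝ} (hV : 0 < V) (h1 : Real.pi / 4 < θ)
    (h2 : θ < Real.pi / 2) : equilateralPath V θ ∈ AE.initial := by
  have hpi := Real.pi_pos
  have hl := extAngle_equilateralPath_left hV θ
  have hr := extAngle_equilateralPath_right hV (by linarith) (by linarith : θ ≤ Real.pi)
  obtain ⟨d01, d12, d23⟩ := dist_equilateralPath hV θ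
  obtain ⟨h02, h13, h03⟩ := dist_lt_of_acute
    (inner_pos_of_extAngle_lt (hl.trans_lt (by linarith)))
    (inner_pos_of_extAngle_lt (hr.trans_lt h2))
  rw [d12] at h02 h13 h03
  refine ⟨?_, ?_, ?_, ?_⟩
  · rw [hl]; positivity
  · rwa [hl, hr]
  · rwa [hr]
  · simp [IsOpenPath, d01, d12, d23, h02, h13, h03]

theorem connected_equilateralPath {V : ℝ} (hV : 0 < V) (θ : ℝ) :
    (visibilityGraph V (equilateralPath V θ)).Connected := by
  obtain ⟨d01, d12, d23⟩ := dist_equilateralPath hV θ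
  have a01 : (visibilityGraph V (equilateralPath V θ)).Adj 0 1 := ⟨by decide, d01.le⟩
  have a12 : (visibilityGraph V (equilateralPath V θ)).Adj 1 2 := ⟨by decide, d12.le⟩
  have a23 : (visibilityGraph V (equilateralPath V θ)).Adj 2 3 := ⟨by decide, d23.le⟩
  rw [SimpleGraph.connected_iff_exists_forall_reachable]
  refine ⟨1, fun i => ?_⟩
  fin_cases i
  exacts [a01.symm.reachable, .rfl, a12.reachable, a12.reachable.trans a23.reachable]

/-- Placements of `AE` which differ in the position of `r₄`, and thereby in `θ₂`, only. -/
theorem exists_family_mem_initial {V : ℝ} (hV : 0 < V) : ∃ (A B C : Plane) (c : ℝ → Placement 4),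
    dist B C = V ∧ ∀ θ, Real.pi / 4 < θ → θ < Real.pi / 2 →
      c θ ∈ AE.initial ∧ (visibilityGraph V (c θ)).Connected ∧
      c θ 0 = A ∧ c θ 1 = B ∧ c θ 2 = C ∧
      extAngle (c θ 0) (c θ 1) (c θ 2) = Real.pi / 4 ∧
      extAngle (c θ 3) (c θ 2) (c θ 1) = θ :=
  ⟨equilateralPath V 0 0, _, _, equilateralPath V, (dist_equilateralPath hV 0).2.1, fun θ h1 h2 =>
    ⟨equilateralPath_mem_initial hV h1 h2, connected_equilateralPath hV θ,
      by simp only [equilateralPath, Matrix.cons_val],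
      by simp only [equilateralPath, Matrix.cons_val],
      by simp only [equilateralPath, Matrix.cons_val],
      extAngle_equilateralPath_left hV θ,
      extAngle_equilateralPath_right hV (by linarith [Real.pi_pos]) (by linarith [Real.pi_pos])⟩⟩

theorem ae_notMem_fsynch_limited (R : Team 4) : AE ∉ LUMI .fsynch .limited 4 R := by
  rintro ⟨P, hP⟩
  have hpi := Real.pi_pos
  have := P.finite_color
  obtain ⟨frame, hframe⟩ := R.frames_nonempty
  obtain ⟨A, B, C, c, hBC, hc⟩ := exists_family_mem_initial R.radius_pos
  have hact : ∀ t : ℕ, (fun _ => Set.univ : ℕ → Set (Fin 4)) t = Set.univ := fun _ => rfl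
  set act : ℕ → Set (Fin 4) := fun _ => Set.univ
  have hvalid : ∀ θ : Set.Ioo (Real.pi / 4) (Real.pi / 2), ∃ T,
      (∀ t < T, HasAngles B C (Real.pi / 4) θ
        fun i => (P.run .limited R.radius frame act (c θ) t i).1) ∧
      HasAngles B C θ θ fun i => (P.run .limited R.radius frame act (c θ) T i).1 := by
    rintro ⟨θ, h1, h2⟩
    obtain ⟨hinit, hconn, -, hB, hC, hl, hr⟩ := hc θ h1 h2
    obtain ⟨-, T, hlt, hT, -⟩ := hP _ hinit hconn frame hframe act hact
    have h0 : ∀ i, (P.run .limited R.radius frame act (c θ) 0 i).1 = c θ i := fun _ => rfl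
    rw [hB, hC] at hl hr
    simp only [h0, hB, hC, hl, hr] at hlt hT
    exact ⟨T, hlt, hT⟩
  choose T hlt hT using hvalid
  have hsep : ∀ θ, ∀ t < T θ, Separated R.radius (P.run .limited R.radius frame act (c θ) t) := by
    intro θ t ht
    rw [← hBC]
    exact separated_of_hasAngles (hBC.symm ▸ hlt θ t ht) (by linarith) θ.2.2
  -- The position of r₃ is constant before `T θ`, so its colors record all that varies; the length
  -- of the word records `T θ`.
  let history : Set.Ioo (Real.pi / 4) (Real.pi / 2) → List P.Color := fun θ =>
    (List.range (T θ)).map fun t => (P.run .limited R.radius frame act (c θ) t 2).2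
  have hinj : Function.Injective history := by
    intro θ θ' h
    have hTT : T θ = T θ' := by simpa [history] using congrArg List.length h
    have hcol : ∀ t < T θ, (P.run .limited R.radius frame act (c θ) t 2).2 =
        (P.run .limited R.radius frame act (c θ') t 2).2 := by
      intro t ht
      simp only [history, ← hTT] at h
      exact List.map_inj_left.1 h t (List.mem_range.2 ht)
    obtain ⟨-, -, hA, hB, -⟩ := hc θ θ.2.1 θ.2.2
    obtain ⟨-, -, hA', hB', -⟩ := hc θ' θ'.2.1 θ'.2.2
    have heq := (run_eq_of_separated P hact (hA.trans hA'.symm) (hB.trans hB'.symm)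
      (fun t ht => Prod.ext ((hlt θ t ht).2.1.trans (hlt θ' t (hTT ▸ ht)).2.1.symm) (hcol t ht))
      (hsep θ) (fun t ht => hsep θ' t (hTT ▸ ht)) (T θ) le_rfl).1
    -- At the common final round r₁ stands at the same point in both runs, yet makes the angles `θ`
    -- and `θ'`.
    have h1 := (hT θ).2.2.1
    have h2 := (hT θ').2.2.1
    rw [← hTT] at h2
    refine Subtype.ext ?_
    rw [← h1, ← h2]
    exact congrArg (fun x : Plane × P.Color => extAngle x.1 B C) heq
  -- Words over a finite alphabet are countable, whereas a nondegenerate real interval has the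
  -- cardinality of the continuum.
  have hcount : (Set.Ioo (Real.pi / 4) (Real.pi / 2)).Countable := hinj.countable
  have := Cardinal.mk_Ioo_real (by linarith : Real.pi / 4 < Real.pi / 2)
  exact Cardinal.aleph0_lt_continuum.not_ge (this ▸ hcount.le_aleph0)

end Robots

theorem mainTheorem3 :
    Robots.Incomparable (Robots.LUMI .fsynch .limited) (Robots.LUMI .ssynch .full) ∧
    (∀ R : Robots.Team 3,
      Robots.EqOsc ∈ Robots.LUMI .fsynch .limited 3 R ∧
      Robots.EqOsc ∉ Robots.LUMI .ssynch .full 3 R) ∧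
    (∀ R : Robots.Team 4,
      Robots.AE ∈ Robots.LUMI .ssynch .full 4 R ∧
      Robots.AE ∉ Robots.LUMI .fsynch .limited 4 R) := by
  have hOsc : ∀ R : Robots.Team 3, Robots.EqOsc ∈ Robots.LUMI .fsynch .limited 3 R ∧
      Robots.EqOsc ∉ Robots.LUMI .ssynch .full 3 R := fun R =>
    ⟨Robots.eqOsc_mem_fsynch_limited R, Robots.eqOsc_notMem_ssynch_full R⟩
  have hAE : ∀ R : Robots.Team 4, Robots.AE ∈ Robots.LUMI .ssynch .full 4 R ∧
      Robots.AE ∉ Robots.LUMI .fsynch .limited 4 R := fun R =>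
    ⟨Robots.ae_mem_ssynch_full R, Robots.ae_notMem_fsynch_limited R⟩
  exact ⟨⟨⟨3, Robots.disorientedTeam 3 (by norm_num), _, hOsc _⟩,
    ⟨4, Robots.disorientedTeam 4 (by norm_num), _, hAE _⟩⟩, hOsc, hAE⟩
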